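/- Conventions: $\widehat g(y)=\int_{\mathbb R}e^{-2\pi i xy}g(x)\,dx$ and $\check g(y)=\widehat g(-y)$. A (Radon) measure on $\mathbb R$ is a complex linear functional $\mu$ on $C_c(\mathbb R)$ such that for every compact $K$ there is $C_K$ with $|\mu(\varphi)|\le C_K\|\varphi\|_\infty$ whenever $\operatorname{supp}\varphi\subseteq K$; $|\mu|$ is its total variation, and $\mu$ is translation bounded if $\sup_{t}|\mu|(t+K)<\infty$ for all compact $K$. The measure $\mu$ is tempered if it agrees on $C_c^\infty(\mathbb R)$ with a (then unique) tempered distribution; we write $\widehat\mu=\nu$ for a measure $\nu$ if the distributional Fourier transform of this distribution agrees with $\nu$ on $C_c^\infty(\mathbb R)$. We say $\widehat\mu=\nu$ in the strict sense if, for all $f\in C_c(\mathbb R)$, $|\check f|^2\in L^1(|\nu|)$ and $\mu(f*\widetilde f\,)=\int|\check f|^2\,d\nu$, where $\widetilde f(x)=\overline{f(-x)}$. A tempered measure $\mu\ne0$ with $\widehat\mu=\lambda\mu$ is an eigenmeasure with eigenvalue $\lambda$; it is a strict eigenmeasure if, in addition, $\widehat\mu=\lambda\mu$ in the strict sense. **Theorem.**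 Let $\theta\in\mathbb R$ and let $\Gamma_\theta\subset\mathbb R^2$ be the rotated square lattice $\Gamma_\theta=\{m(\cos\theta,\sin\theta)+n(-\sin\theta,\cos\theta): m,n\in\mathbb Z\}$. Let $g\ne0$ be a Schwartz function on $\mathbb R$ with $\widehat g=\lambda g$ for some $\lambda\in\mathbb C$ (so that $\lambda\in\{1,i,-1,-i\}$). Then $$\omega_g(\varphi)=\sum_{(x,y)\in\Gamma_\theta}\varphi(x)\,g(y)$$ converges absolutely for all $\varphi\in C_c(\mathbb R)$ and for all Schwartz functions $\varphi$, and defines a translation-bounded measure which is tempered, the corresponding tempered distribution being given by the same formula. It satisfies $\widehat{\omega_g}=\overline\lambda\,\omega_g$, both as tempered distributions and in the strict sense. Consequently, $\omega_g$ is a strict eigenmeasure of the Fourier transform with eigenvalue $\overline\lambda$ whenever $\omega_g\neq0$; and this is always the case if $\tan\theta$ is irrational. -/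

import Mathlib

open MeasureTheory
open scoped ENNReal FourierTransform SchwartzMap CompactlySupported ComplexConjugate Convolution

noncomputable section

/-- The complex vector space of (complex) Radon measures on `ℝ`, viewed as linear functionals `μ` on
`C_c(ℝ)`: for every compact `K` there is a constant `C` such that `|μ(φ)| ≤ C ‖φ‖_∞` for all
`φ ∈ C_c(ℝ)` with support in `K`. -/
def radonSubmodule : Submodule ℂ (C_c(ℝ, ℂ) →ₗ[ℂ] ℂ) where
  carrier := {μ | ∀ K : Set ℝ, IsCompact K → ∃ C : ℝ, ∀ φ : C_c(ℝ, ℂ),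
    tsupport φ ⊆ K → ‖μ φ‖ ≤ C * ⨆ x, ‖φ x‖}
  zero_mem' := fun _ _ => ⟨0, fun _ _ => by simp⟩
  add_mem' := by
    intro μ ν hμ hν K hK
    obtain ⟨C, hC⟩ := hμ K hK
    obtain ⟨D, hD⟩ := hν K hK
    refine ⟨C + D, fun φ hφ => ?_⟩
    rw [LinearMap.add_apply, add_mul]
    exact (norm_add_le _ _).trans (add_le_add (hC φ hφ) (hD φ hφ))
  smul_mem' := by
    intro c μ hμ K hK
    obtain ⟨C, hC⟩ := hμ K hK
    refine ⟨‖c‖ * C, fun φ hφ => ?_⟩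
    rw [LinearMap.smul_apply, norm_smul, mul_assoc]
    exact mul_le_mul_of_nonneg_left (hC φ hφ) (norm_nonneg c)

/-- A (complex) Radon measure on `ℝ`. -/
abbrev RadonMeasure : Type := radonSubmodule

namespace RadonMeasure

/-- The total variation `|μ|` of a Radon measure `μ`: the smallest positive Radon (i.e. locally
finite Borel) measure `ν` on `ℝ` with `|μ(φ)| ≤ ν(|φ|)` for all `φ ∈ C_c(ℝ)`. -/
def totalVariation (μ : RadonMeasure) : Measure ℝ :=
  sInf {ν : Measure ℝ | IsLocallyFiniteMeasure ν ∧
    ∀ φ : C_c(ℝ, ℂ), ‖μ.1 φ‖ₑ ≤ ∫⁻ x, ‖φ x‖ₑ ∂ν}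

/-- `sup_t |μ|(t + K) < ∞` for every compact `K`. -/
def TranslationBounded (μ : RadonMeasure) : Prop :=
  ∀ K : Set ℝ, IsCompact K → ⨆ t : ℝ, μ.totalVariation ((fun x => t + x) '' K) < ∞

/-- `h ∈ L¹(|μ|)` and `∫ h dμ = z`. The integral against the complex measure `μ` is taken through
its polar decomposition `μ = u |μ|` with `|u| = 1`. -/
def HasIntegral (μ : RadonMeasure) (h : ℝ → ℂ) (z : ℂ) : Prop :=
  Integrable h μ.totalVariation ∧
    ∃ u : ℝ → ℂ, Measurable u ∧ (∀ x, ‖u x‖ = 1) ∧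
      (∀ φ : C_c(ℝ, ℂ), μ.1 φ = ∫ x, φ x * u x ∂μ.totalVariation) ∧
      ∫ x, h x * u x ∂μ.totalVariation = z

/-- The tempered distribution `T` is the one defined by the measure `μ`: both agree on
`C_c^∞(ℝ)`. As this space is dense in `𝓢(ℝ)`, there is at most one such `T`. -/
def IsRepresentedBy (μ : RadonMeasure) (T : 𝓢'(ℝ, ℂ)) : Prop :=
  ∀ (φ : 𝓢(ℝ, ℂ)) (hφ : HasCompactSupport φ), T φ = μ.1 ⟨⟨φ, φ.continuous⟩, hφ⟩

/-- The measure `μ` is tempered and transformable, and its distributional Fourier transform is the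
measure `ν`. -/
def HasFourierTransform (μ ν : RadonMeasure) : Prop :=
  ∃ T : 𝓢'(ℝ, ℂ), μ.IsRepresentedBy T ∧ ν.IsRepresentedBy (𝓕 T)

end RadonMeasure

/-- `f * f̃` with `f̃(x) = conj (f (-x))`, for `f ∈ C_c(ℝ)`, as an element of `C_c(ℝ)`. -/
def autocorrelation (f : C_c(ℝ, ℂ)) : C_c(ℝ, ℂ) where
  toFun := (f : ℝ → ℂ) ⋆[ContinuousLinearMap.mul ℝ ℂ] (fun x => conj (f (-x)))
  continuous_toFun := by
    refine HasCompactSupport.continuous_convolution_left _ f.hasCompactSupport f.continuous ?_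
    exact (Complex.continuous_conj.comp (f.continuous.comp continuous_neg)).locallyIntegrable
  hasCompactSupport' := by
    refine HasCompactSupport.convolution _ f.hasCompactSupport ?_
    exact (f.hasCompactSupport.comp_homeomorph (Homeomorph.neg ℝ)).comp_left
      (g := fun z : ℂ => conj z) (map_zero _)

namespace RadonMeasure

/-- The measure `μ` is transformable in the strict sense (as a measure, without distribution
theory), with transform the measure `ν`: for every `f ∈ C_c(ℝ)`, with inverse Fourier transform
`f̌`, one has `|f̌|² ∈ L¹(|ν|)` and `μ(f * f̃) = ∫ |f̌|² dν`. -/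
def HasStrictFourierTransform (μ ν : RadonMeasure) : Prop :=
  ∀ f : C_c(ℝ, ℂ),
    ν.HasIntegral (fun y => ((‖𝓕⁻ (f : ℝ → ℂ) y‖ ^ 2 : ℝ) : ℂ)) (μ.1 (autocorrelation f))

/-- `μ` is an eigenmeasure of the Fourier transform with eigenvalue `lam`. -/
def IsEigenmeasure (μ : RadonMeasure) (lam : ℂ) : Prop :=
  μ ≠ 0 ∧ μ.HasFourierTransform (lam • μ)

/-- `μ` is a strict eigenmeasure of the Fourier transform with eigenvalue `lam`. -/
def IsStrictEigenmeasure (μ : RadonMeasure) (lam : ℂ) : Prop :=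
  μ.IsEigenmeasure lam ∧ μ.HasStrictFourierTransform (lam • μ)

end RadonMeasure

/-- The matrix whose columns are the basis vectors of the rotated square lattice. -/
def rotatedBasis (θ : ℝ) : Matrix (Fin 2) (Fin 2) ℝ :=
  !![Real.cos θ, -Real.sin θ; Real.sin θ, Real.cos θ]

/-- The rotated square lattice in `ℝ²`: the integer span of the columns of the basis matrix. -/
def rotatedLattice (θ : ℝ) : Submodule ℤ (Fin 2 → ℝ) :=
  Submodule.span ℤ (Set.range (rotatedBasis θ).col)

end

/-! A rotation preserves the inner product, so the rotated square lattice is its own dual, and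
Poisson summation over its points reads `∑ φ(x) ψ(y) = ∑ 𝓕⁻φ(x) 𝓕⁻ψ(y)`
(`hasSum_fourierInv_mul_rot`). For `ψ = g` one has `𝓕⁻ g = conj lam • g`, which turns this into the
eigenvalue equation: inserting `𝓕 φ` gives the distributional statement, and inserting `f * f̃`,
whose inverse transform is `|f̌|²`, gives the strict one.

The analytic content is convergence. Rapidly decaying terms are compared with `planeKernel`, whose
sums over translates of `ℤ²` are uniformly bounded; this also yields translation boundedness. In the
strict case `|f̌|²` is only known to be integrable (Plancherel), without pointwise decay. Being the
transform of a compactly supported function, it reproduces itself under convolution with a Schwartz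
function, and the lattice sum can be taken under the integral (`summable_norm_fourier_mul_rot`).

Claims about `|ω|` need it explicitly. Lattice points may share a first coordinate, so weights are
added along fibres before taking absolute values (`totalVariation_eq`). If `tan θ` is irrational,
first coordinates are distinct and second coordinates dense, so some weight `g(y) ≠ 0` survives. -/

/-! ### Decay kernels and their sums over translates of the integer lattice. -/

/-- The Poisson-type kernel `1 / (1 + x²)`. -/
noncomputable def decayKernel (x : ℝ) : ℝ := (1 + x ^ 2)⁻¹

lemma decayKernel_pos (x : ℝ) : 0 < decayKernel x := by unfold decayKernel; positivity

lemma decayKernel_le_one (x : ℝ) : decayKernel x ≤ 1 :=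
  inv_le_one_of_one_le₀ (by nlinarith [sq_nonneg x])

lemma continuous_decayKernel : Continuous decayKernel := by
  unfold decayKernel
  exact Continuous.inv₀ (by fun_prop) fun x => by positivity

lemma integrable_decayKernel : Integrable decayKernel := integrable_inv_one_add_sq

/-- Equivalent to `1 + x² ≤ 2 (1 + a²) (1 + (x - a)²)`, which follows from `x² ≤ 2 a² + 2 (x - a)²`.
-/
lemma decayKernel_sub_le (x a : ℝ) :
    decayKernel (x - a) ≤ 2 * (1 + a ^ 2) * decayKernel x := by
  unfold decayKernel
  rw [← div_eq_mul_inv, inv_eq_one_div, div_le_div_iff₀ (by positivity) (by positivity)]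
  nlinarith [sq_nonneg (x - 2 * a), sq_nonneg (a * (x - a)), sq_nonneg (x - a)]

lemma summable_decayKernel_int : Summable fun n : ℤ => decayKernel n := by
  have h : Summable fun n : ℤ => ((n : ℝ) ^ 2)⁻¹ := by
    simpa using (Real.summable_one_div_int_pow (p := 2)).2 one_lt_two
  refine Summable.of_norm_bounded_eventually h ?_
  rw [Filter.eventually_cofinite]
  refine (Set.finite_singleton (0 : ℤ)).subset fun n hn => ?_
  by_contra h0
  apply hn
  have h0 : (n : ℝ) ≠ 0 := by exact_mod_cast h0
  rw [Real.norm_of_nonneg (decayKernel_pos _).le]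
  exact inv_anti₀ (by positivity) (by linarith)

lemma summable_decayKernel_int_sub (a : ℝ) : Summable fun n : ℤ => decayKernel (n - a) :=
  .of_nonneg_of_le (fun _ => (decayKernel_pos _).le) (fun n => decayKernel_sub_le n a)
    (summable_decayKernel_int.mul_left _)

/-- Shifting the index by `⌊a⌋` replaces `a` by its fractional part, for which the factor `2 (1 +
a²)` is at most 4. Uniformity in `a` is the point. -/
lemma tsum_decayKernel_int_sub_le (a : ℝ) :
    ∑' n : ℤ, decayKernel (n - a) ≤ 4 * ∑' n : ℤ, decayKernel n := by
  have h1 : ∑' n : ℤ, decayKernel (n - a) = ∑' n : ℤ, decayKernel (n - Int.fract a) := by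
    rw [← (Equiv.addRight ⌊a⌋).tsum_eq fun n : ℤ => decayKernel (n - a)]
    refine tsum_congr fun n => ?_
    congr 1
    simp only [Equiv.coe_addRight, Int.cast_add, Int.fract]
    ring
  rw [h1, ← tsum_mul_left]
  refine (summable_decayKernel_int_sub _).tsum_le_tsum (fun n => ?_)
    (summable_decayKernel_int.mul_left _)
  refine (decayKernel_sub_le _ _).trans (mul_le_mul_of_nonneg_right ?_ (decayKernel_pos _).le)
  nlinarith [Int.fract_nonneg a, Int.fract_lt_one a]

/-- The kernel `1 / ((1 + x₀²) (1 + x₁²))` on the plane. -/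
noncomputable def planeKernel (x : Fin 2 → ℝ) : ℝ := decayKernel (x 0) * decayKernel (x 1)

lemma planeKernel_pos (x : Fin 2 → ℝ) : 0 < planeKernel x :=
  mul_pos (decayKernel_pos _) (decayKernel_pos _)

lemma planeKernel_sub_le (x a : Fin 2 → ℝ) :
    planeKernel (x - a) ≤ 2 * (1 + a 0 ^ 2) * (2 * (1 + a 1 ^ 2)) * planeKernel x := by
  have h := mul_le_mul (decayKernel_sub_le (x 0) (a 0)) (decayKernel_sub_le (x 1) (a 1))
    (decayKernel_pos _).le (by have := decayKernel_pos (x 0); positivity)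
  calc _ ≤ _ := h
    _ = _ := by unfold planeKernel; ring

/-- The inclusion of `ℤ²` in the plane. -/
def intVec (n : Fin 2 → ℤ) : Fin 2 → ℝ := fun i => n i

lemma intVec_add (m n : Fin 2 → ℤ) : intVec (m + n) = intVec m + intVec n := by
  ext i; simp [intVec]

lemma intVec_neg (n : Fin 2 → ℤ) : intVec (-n) = -intVec n := by
  ext i; simp [intVec]

lemma hasSum_planeKernel_intVec_sub (a : Fin 2 → ℝ) :
    HasSum (fun n : Fin 2 → ℤ => planeKernel (intVec n - a))
      ((∑' n : ℤ, decayKernel (n - a 0)) * ∑' n : ℤ, decayKernel (n - a 1)) := by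
  rw [← (finTwoArrowEquiv ℤ).symm.hasSum_iff]
  have h0 := summable_decayKernel_int_sub (a 0)
  have h1 := summable_decayKernel_int_sub (a 1)
  have h := h0.hasSum.mul h1.hasSum
    (h0.mul_of_nonneg h1 (fun _ => (decayKernel_pos _).le) fun _ => (decayKernel_pos _).le)
  refine h.congr_fun fun x => ?_
  simp [planeKernel, intVec]

lemma summable_planeKernel_intVec : Summable fun n : Fin 2 → ℤ => planeKernel (intVec n) := by
  simpa using (hasSum_planeKernel_intVec_sub 0).summable

/-- A bound for `∑ n, planeKernel (n - a)` which is uniform in `a`. -/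
noncomputable def planeKernelBound : ℝ := (4 * ∑' n : ℤ, decayKernel n) ^ 2

lemma tsum_planeKernel_intVec_sub_le (a : Fin 2 → ℝ) :
    ∑' n : Fin 2 → ℤ, planeKernel (intVec n - a) ≤ planeKernelBound := by
  rw [(hasSum_planeKernel_intVec_sub a).tsum_eq, planeKernelBound, sq]
  exact mul_le_mul (tsum_decayKernel_int_sub_le _) (tsum_decayKernel_int_sub_le _)
    (tsum_nonneg fun _ => (decayKernel_pos _).le)
    (mul_nonneg (by norm_num) (tsum_nonneg fun _ => (decayKernel_pos _).le))

/-! ### Rotated coordinates and decay conditions. -/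

/-- The first coordinate of the rotated vector. -/
noncomputable def rotFst (θ : ℝ) (x : Fin 2 → ℝ) : ℝ := Real.cos θ * x 0 - Real.sin θ * x 1

/-- The second coordinate of the rotated vector. -/
noncomputable def rotSnd (θ : ℝ) (x : Fin 2 → ℝ) : ℝ := Real.sin θ * x 0 + Real.cos θ * x 1

@[fun_prop]
lemma continuous_rotFst (θ : ℝ) : Continuous (rotFst θ) := by unfold rotFst; fun_prop

@[fun_prop]
lemma continuous_rotSnd (θ : ℝ) : Continuous (rotSnd θ) := by unfold rotSnd; fun_prop

lemma rotFst_mul_add_rotSnd_mul (θ : ℝ) (x y : Fin 2 → ℝ) :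
    rotFst θ x * rotFst θ y + rotSnd θ x * rotSnd θ y = x 0 * y 0 + x 1 * y 1 := by
  unfold rotFst rotSnd
  linear_combination (x 0 * y 0 + x 1 * y 1) * Real.sin_sq_add_cos_sq θ

lemma rotFst_neg (θ : ℝ) (x : Fin 2 → ℝ) : rotFst θ (-x) = -rotFst θ x := by
  simp [rotFst]; ring

lemma rotSnd_neg (θ : ℝ) (x : Fin 2 → ℝ) : rotSnd θ (-x) = -rotSnd θ x := by
  simp [rotSnd]; ring

/-- The vector with rotated coordinates `(t, 0)`. -/
noncomputable def rotInvFst (θ t : ℝ) : Fin 2 → ℝ := ![Real.cos θ * t, -Real.sin θ * t]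

lemma rotFst_sub_rotInvFst (θ t : ℝ) (x : Fin 2 → ℝ) :
    rotFst θ (x - rotInvFst θ t) = rotFst θ x - t := by
  simp only [rotFst, rotInvFst, Pi.sub_apply, Matrix.cons_val_zero, Matrix.cons_val_one]
  linear_combination -t * Real.sin_sq_add_cos_sq θ

lemma rotSnd_sub_rotInvFst (θ t : ℝ) (x : Fin 2 → ℝ) :
    rotSnd θ (x - rotInvFst θ t) = rotSnd θ x := by
  simp only [rotSnd, rotInvFst, Pi.sub_apply, Matrix.cons_val_zero, Matrix.cons_val_one]
  ring

/-- With `u, v` the rotated coordinates, `(1 + x₀²)(1 + x₁²) ≤ (1 + |x|²)² ≤ ((1 + u²)(1 + v²))²`,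
as rotation preserves the norm. Passing between coordinate systems costs a square, which is why
`HasDecay` asks for one. -/
lemma decayKernel_rot_le (θ : ℝ) (x : Fin 2 → ℝ) :
    decayKernel (rotFst θ x) ^ 2 * decayKernel (rotSnd θ x) ^ 2 ≤ planeKernel x := by
  have h := rotFst_mul_add_rotSnd_mul θ x x
  unfold planeKernel decayKernel
  set u := rotFst θ x
  set v := rotSnd θ x
  rw [← mul_pow, ← mul_inv, ← mul_inv, inv_pow]
  refine inv_anti₀ (by positivity) ?_
  have h1 : 1 + x 0 ^ 2 + x 1 ^ 2 ≤ (1 + u ^ 2) * (1 + v ^ 2) := by nlinarith [sq_nonneg (u * v)]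
  calc (1 + x 0 ^ 2) * (1 + x 1 ^ 2) ≤ (1 + x 0 ^ 2 + x 1 ^ 2) ^ 2 := by
        nlinarith [sq_nonneg (x 0), sq_nonneg (x 1), mul_nonneg (sq_nonneg (x 0)) (sq_nonneg (x 1))]
    _ ≤ _ := by gcongr

/-- `φ` decays like the square of `decayKernel`. -/
def HasDecay (φ : ℝ → ℂ) : Prop := ∃ C : ℝ, ∀ x, ‖φ x‖ ≤ C * decayKernel x ^ 2

lemma HasDecay.exists_nonneg {φ : ℝ → ℂ} (h : HasDecay φ) :
    ∃ C : ℝ, 0 ≤ C ∧ ∀ x, ‖φ x‖ ≤ C * decayKernel x ^ 2 := by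
  obtain ⟨C, hC⟩ := h
  refine ⟨C, ?_, hC⟩
  have := (norm_nonneg _).trans (hC 0)
  exact nonneg_of_mul_nonneg_left this (pow_pos (decayKernel_pos 0) 2)

lemma norm_mul_rot_le {φ ψ : ℝ → ℂ} {C D : ℝ} (hC : ∀ x, ‖φ x‖ ≤ C * decayKernel x ^ 2)
    (hD : ∀ x, ‖ψ x‖ ≤ D * decayKernel x ^ 2) (hC0 : 0 ≤ C) (hD0 : 0 ≤ D)
    (θ : ℝ) (x : Fin 2 → ℝ) :
    ‖φ (rotFst θ x) * ψ (rotSnd θ x)‖ ≤ C * D * planeKernel x := by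
  rw [norm_mul]
  calc _ ≤ (C * decayKernel (rotFst θ x) ^ 2) * (D * decayKernel (rotSnd θ x) ^ 2) :=
        mul_le_mul (hC _) (hD _) (norm_nonneg _) (by positivity)
    _ = C * D * (decayKernel (rotFst θ x) ^ 2 * decayKernel (rotSnd θ x) ^ 2) := by ring
    _ ≤ _ := mul_le_mul_of_nonneg_left (decayKernel_rot_le θ x) (by positivity)

lemma HasDecay.of_hasCompactSupport {φ : ℝ → ℂ} (hφ : Continuous φ) (h : HasCompactSupport φ) :
    HasDecay φ := by
  have hc : Continuous fun x => φ x * ((1 + x ^ 2) ^ 2 : ℝ) := by fun_prop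
  obtain ⟨C, hC⟩ := hc.bounded_above_of_compact_support (h.mul_right)
  refine ⟨C, fun x => ?_⟩
  have h1 := hC x
  rw [norm_mul, Complex.norm_real, Real.norm_of_nonneg (by positivity)] at h1
  rw [decayKernel, inv_pow, ← div_eq_mul_inv, le_div_iff₀ (by positivity)]
  exact h1

lemma one_add_sq_le (x : ℝ) : 1 + x ^ 2 ≤ (1 + ‖x‖) ^ 2 := by
  rw [Real.norm_eq_abs]
  nlinarith [abs_nonneg x, sq_abs x]

/-- The Schwartz seminorm which controls the decay of order four. -/
noncomputable def decaySeminorm : Seminorm ℂ 𝓢(ℝ, ℂ) :=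
  (Finset.Iic (4, 0)).sup (schwartzSeminormFamily ℂ ℝ ℂ)

/-- The constant is an explicit seminorm because continuity of `latticeDistribution` rests on it. -/
lemma SchwartzMap.norm_le_decaySeminorm (φ : 𝓢(ℝ, ℂ)) (x : ℝ) :
    ‖φ x‖ ≤ 2 ^ 4 * decaySeminorm φ * decayKernel x ^ 2 := by
  have h := SchwartzMap.one_add_le_sup_seminorm_apply (𝕜 := ℂ) (m := (4, 0)) le_rfl le_rfl φ x
  rw [norm_iteratedFDeriv_zero] at h
  rw [decayKernel, inv_pow, ← div_eq_mul_inv, le_div_iff₀ (by positivity)]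
  refine le_trans ?_ h
  rw [mul_comm]
  refine mul_le_mul_of_nonneg_right ?_ (norm_nonneg _)
  calc _ ≤ ((1 + ‖x‖) ^ 2) ^ 2 := by gcongr; exact one_add_sq_le x
    _ = _ := by ring

lemma SchwartzMap.hasDecay (φ : 𝓢(ℝ, ℂ)) : HasDecay φ := ⟨_, φ.norm_le_decaySeminorm⟩

lemma summable_norm_mul_rot {φ ψ : ℝ → ℂ} (hφ : HasDecay φ) (hψ : HasDecay ψ) (θ : ℝ) :
    Summable fun n : Fin 2 → ℤ => ‖φ (rotFst θ (intVec n)) * ψ (rotSnd θ (intVec n))‖ := by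
  obtain ⟨C, hC0, hC⟩ := hφ.exists_nonneg
  obtain ⟨D, hD0, hD⟩ := hψ.exists_nonneg
  exact .of_nonneg_of_le (fun _ => norm_nonneg _)
    (fun n => norm_mul_rot_le hC hD hC0 hD0 θ (intVec n)) (summable_planeKernel_intVec.mul_left _)

/-! ### Poisson summation for the integer lattice. -/

/-- The projection from the plane to the torus. -/
def toTorus (x : Fin 2 → ℝ) : UnitAddTorus (Fin 2) := fun i => (x i : UnitAddCircle)

lemma toTorus_add_intVec (x : Fin 2 → ℝ) (n : Fin 2 → ℤ) : toTorus (x + intVec n) = toTorus x := by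
  ext i
  simp only [toTorus, Pi.add_apply, intVec, AddCircle.coe_add, add_eq_left]
  exact (AddCircle.coe_eq_zero_iff 1).2 ⟨n i, by simp⟩

lemma exists_intVec_of_toTorus_eq {x y : Fin 2 → ℝ} (h : toTorus x = toTorus y) :
    ∃ n : Fin 2 → ℤ, y = x + intVec n := by
  have h1 : ∀ i, ∃ n : ℤ, y i = x i + n := fun i => by
    have h2 : ((y i - x i : ℝ) : UnitAddCircle) = 0 := by
      rw [AddCircle.coe_sub, sub_eq_zero]; exact (congrFun h i).symm
    obtain ⟨n, hn⟩ := (AddCircle.coe_eq_zero_iff 1).1 h2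
    exact ⟨n, by simp at hn; linarith⟩
  choose n hn using h1
  exact ⟨n, funext hn⟩

lemma isOpenQuotientMap_toTorus : IsOpenQuotientMap toTorus :=
  IsOpenQuotientMap.piMap (f := fun _ (t : ℝ) => (t : UnitAddCircle))
    fun _ => QuotientAddGroup.isOpenQuotientMap_mk

@[fun_prop]
lemma continuous_toTorus : Continuous toTorus := isOpenQuotientMap_toTorus.continuous

/-- The half-open unit square with lower left corner `n`. -/
def unitSquare (n : Fin 2 → ℤ) : Set (Fin 2 → ℝ) := {x | ∀ i, x i ∈ Set.Ioc (n i : ℝ) (n i + 1)}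

lemma mem_unitSquare_iff {n : Fin 2 → ℤ} {x : Fin 2 → ℝ} :
    x ∈ unitSquare n ↔ (fun i => ⌈x i⌉ - 1) = n := by
  simp only [unitSquare, Set.mem_ofPred_eq, funext_iff, Set.mem_Ioc]
  refine forall_congr' fun i => ?_
  rw [sub_eq_iff_eq_add, Int.ceil_eq_iff]
  push_cast
  simp

lemma measurableSet_unitSquare (n : Fin 2 → ℤ) : MeasurableSet (unitSquare n) :=
  MeasurableSet.univ_pi' fun _ => measurableSet_Ioc

lemma iUnion_unitSquare : ⋃ n, unitSquare n = Set.univ := by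
  ext x; simp [mem_unitSquare_iff]

lemma pairwise_disjoint_unitSquare : Pairwise (Function.onFun Disjoint unitSquare) := by
  intro m n hmn
  refine Set.disjoint_left.2 fun x hm hn => hmn ?_
  rw [mem_unitSquare_iff] at hm hn
  exact hm.symm.trans hn

lemma setIntegral_unitSquare {E : Type*} [NormedAddCommGroup E] [NormedSpace ℝ E]
    (f : (Fin 2 → ℝ) → E) (n : Fin 2 → ℤ) :
    ∫ x in unitSquare n, f x = ∫ x in unitSquare 0, f (x + intVec n) := by
  have h := (measurePreserving_add_right (volume : Measure (Fin 2 → ℝ))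
    (intVec n)).setIntegral_preimage_emb
    (measurableEmbedding_addRight _) f (unitSquare n)
  rw [← h]
  congr 2
  ext x
  simp [unitSquare, intVec, add_comm]

lemma hasSum_setIntegral_unitSquare {E : Type*} [NormedAddCommGroup E] [NormedSpace ℝ E]
    {f : (Fin 2 → ℝ) → E} (hf : Integrable f) :
    HasSum (fun n => ∫ x in unitSquare 0, f (x + intVec n)) (∫ x, f x) := by
  have h := hasSum_integral_iUnion (f := f) measurableSet_unitSquare pairwise_disjoint_unitSquare
    hf.integrableOn
  rw [iUnion_unitSquare, setIntegral_univ] at h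
  exact h.congr_fun fun n => (setIntegral_unitSquare f n).symm

/-- Sum and integral may be exchanged because the integrals of the norms over the unit squares add
up to `∫ ‖f‖`. -/
lemma setIntegral_tsum_unitSquare {f : (Fin 2 → ℝ) → ℂ} (hf : Integrable f) :
    ∫ x in unitSquare 0, ∑' n, f (x + intVec n) = ∫ x, f x := by
  have h := hasSum_integral_of_summable_integral_norm (μ := volume.restrict (unitSquare 0))
    (F := fun n x => f (x + intVec n)) (fun n => (hf.comp_add_right _).integrableOn)
    (hasSum_setIntegral_unitSquare hf.norm).summable
  exact h.unique (hasSum_setIntegral_unitSquare hf)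

lemma integrable_planeKernel : Integrable planeKernel := by
  have h := integrable_decayKernel.mul_prod integrable_decayKernel
  exact ((volume_preserving_finTwoArrow ℝ).integrable_comp_emb
    (MeasurableEquiv.finTwoArrow).measurableEmbedding).2 h

section Poisson

variable {F : (Fin 2 → ℝ) → ℂ} {C : ℝ}

lemma integrable_of_le_planeKernel (hF : Continuous F) (hC : ∀ x, ‖F x‖ ≤ C * planeKernel x) :
    Integrable F :=
  (integrable_planeKernel.const_mul C).mono' hF.aestronglyMeasurable (.of_forall hC)

lemma continuous_tsum_add_intVec (hF : Continuous F) (hC : ∀ x, ‖F x‖ ≤ C * planeKernel x) :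
    Continuous fun x => ∑' n, F (x + intVec n) := by
  have hC0 : 0 ≤ C := nonneg_of_mul_nonneg_left ((norm_nonneg _).trans (hC 0)) (planeKernel_pos 0)
  rw [continuous_iff_continuousAt]
  intro x₀
  set R := ‖x₀‖ + 1
  -- On a bounded set the translates of the kernel are dominated by a multiple of the untranslated
  -- one, so the series converges locally uniformly.
  have hon : ContinuousOn (fun x => ∑' n, F (x + intVec n)) (Metric.ball 0 R) := by
    refine continuousOn_tsum (u := fun n =>
        C * (2 * (1 + R ^ 2) * (2 * (1 + R ^ 2)) * planeKernel (intVec n)))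
      (fun n => (by fun_prop : Continuous fun x => F (x + intVec n)).continuousOn)
      ((summable_planeKernel_intVec.mul_left _).mul_left _) fun n x hx => ?_
    refine (hC _).trans (mul_le_mul_of_nonneg_left ?_ hC0)
    have h := planeKernel_sub_le (intVec n) (-x)
    rw [sub_neg_eq_add, add_comm] at h
    refine h.trans (mul_le_mul_of_nonneg_right ?_ (planeKernel_pos _).le)
    have hi : ∀ i, (-x) i ^ 2 ≤ R ^ 2 := fun i => by
      rw [Pi.neg_apply, neg_sq, sq_le_sq, abs_of_nonneg (by positivity : 0 ≤ R)]
      exact (norm_le_pi_norm x i).trans (mem_ball_zero_iff.1 hx).le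
    have h0 := hi 0
    have h1 := hi 1
    gcongr
  exact hon.continuousAt (Metric.isOpen_ball.mem_nhds (by simp [R]))

/-- **Poisson summation** for the lattice `ℤ²`. -/
theorem hasSum_integral_mFourier (hF : Continuous F) (hC : ∀ x, ‖F x‖ ≤ C * planeKernel x)
    (hsum : Summable fun n : Fin 2 → ℤ => ∫ x, UnitAddTorus.mFourier (-n) (toTorus x) * F x) :
    HasSum (fun n : Fin 2 → ℤ => ∫ x, UnitAddTorus.mFourier (-n) (toTorus x) * F x)
      (∑' n, F (intVec n)) := by
  let P : C(Fin 2 → ℝ, ℂ) := ⟨fun x => ∑' n, F (x + intVec n), continuous_tsum_add_intVec hF hC⟩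
  -- The periodization of `F` descends to a continuous function `Q` on the torus.
  have hP : Function.FactorsThrough P toTorus := by
    intro x y hxy
    obtain ⟨m, rfl⟩ := exists_intVec_of_toTorus_eq hxy
    change ∑' n, F (x + intVec n) = ∑' n, F (x + intVec m + intVec n)
    rw [← (Equiv.addLeft m).tsum_eq fun n => F (x + intVec n)]
    simp only [Equiv.coe_addLeft, intVec_add, add_assoc]
  let q : C(Fin 2 → ℝ, UnitAddTorus (Fin 2)) := ⟨toTorus, continuous_toTorus⟩
  have hq : Topology.IsQuotientMap q := isOpenQuotientMap_toTorus.isQuotientMap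
  let Q : C(UnitAddTorus (Fin 2), ℂ) := hq.lift P hP
  have hQ : ∀ x, Q (toTorus x) = ∑' n, F (x + intVec n) := fun x =>
    DFunLike.congr_fun (hq.lift_comp P hP) x
  -- Unfolding: characters are periodic, so integrating the periodization over one square is
  -- integrating `F` over the plane.
  have hcoeff : UnitAddTorus.mFourierCoeff Q =
      fun n : Fin 2 → ℤ => ∫ x, UnitAddTorus.mFourier (-n) (toTorus x) * F x := by
    ext n
    have hint : Integrable fun x => UnitAddTorus.mFourier (-n) (toTorus x) * F x := by
      refine (integrable_of_le_planeKernel hF hC).bdd_mul (c := 1)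
        (by fun_prop : Continuous fun x =>
          UnitAddTorus.mFourier (-n) (toTorus x)).aestronglyMeasurable (.of_forall fun x => ?_)
      exact ((UnitAddTorus.mFourier (-n)).norm_coe_le_norm _).trans UnitAddTorus.mFourier_norm.le
    rw [← setIntegral_tsum_unitSquare hint, UnitAddTorus.mFourierCoeff_eq_integral _ _ 0]
    simp only [toTorus_add_intVec, tsum_mul_left]
    change ∫ x in {x : Fin 2 → ℝ | _}, UnitAddTorus.mFourier (-n) (toTorus x) • Q (toTorus x) = _
    simp only [hQ, smul_eq_mul]
    congr 2
    simp [unitSquare]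
  rw [← hcoeff] at hsum ⊢
  -- The Fourier series of `Q` evaluated at the origin, where every character equals 1.
  have h := UnitAddTorus.hasSum_mFourier_series_apply_of_summable hsum (toTorus 0)
  rw [hQ] at h
  have h1 : ∀ n : Fin 2 → ℤ, UnitAddTorus.mFourier n (toTorus 0) = 1 := fun n => by
    simp [UnitAddTorus.mFourier, toTorus]
  simpa [h1] using h

end Poisson

/-! ### Poisson summation for the rotated lattice. -/

lemma measurePreserving_rot (θ : ℝ) :
    MeasurePreserving (fun x : Fin 2 → ℝ => (rotFst θ x, rotSnd θ x)) := by
  have hdet : (rotatedBasis θ).det = 1 := by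
    rw [rotatedBasis, Matrix.det_fin_two_of]
    linear_combination Real.sin_sq_add_cos_sq θ
  have h1 : MeasurePreserving (Matrix.toLin' (rotatedBasis θ)) := by
    refine ⟨(LinearMap.continuous_of_finiteDimensional _).measurable, ?_⟩
    rw [Real.map_matrix_volume_pi_eq_smul_volume_pi (by rw [hdet]; exact one_ne_zero), hdet]
    simp
  have h2 := (volume_preserving_finTwoArrow ℝ).comp h1
  convert! h2 using 1
  ext x <;> simp [rotatedBasis, rotFst, rotSnd, Matrix.mulVec, dotProduct, Fin.sum_univ_two]
  ring

lemma integral_rot {f g : ℝ → ℂ} (hf : Continuous f) (hg : Continuous g) (θ : ℝ) :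
    ∫ x, f (rotFst θ x) * g (rotSnd θ x) = (∫ x, f x) * ∫ x, g x := by
  have h := measurePreserving_rot θ
  rw [← integral_prod_mul, ← Measure.volume_eq_prod, ← h.map_eq, integral_map h.aemeasurable]
  exact (by fun_prop : Continuous fun z : ℝ × ℝ => f z.1 * g z.2).aestronglyMeasurable

/-- Invariance of the inner product under rotation splits the character along the rotated axes; this
is where self-duality of the lattice enters. -/
lemma mFourier_neg_toTorus (θ : ℝ) (n : Fin 2 → ℤ) (x : Fin 2 → ℝ) :
    UnitAddTorus.mFourier (-n) (toTorus x) =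
      Complex.exp (((-2 * Real.pi * rotFst θ x * rotFst θ (intVec n) : ℝ) : ℂ) * Complex.I) *
      Complex.exp (((-2 * Real.pi * rotSnd θ x * rotSnd θ (intVec n) : ℝ) : ℂ) * Complex.I) := by
  simp only [UnitAddTorus.mFourier, ContinuousMap.coe_mk, Fin.prod_univ_two, toTorus,
    fourier_coe_apply]
  rw [← Complex.exp_add, ← Complex.exp_add]
  congr 1
  have h := congrArg (fun r : ℝ => (r : ℂ)) (rotFst_mul_add_rotSnd_mul θ x (intVec n))
  simp only [intVec] at h
  push_cast at h ⊢
  simp only [Pi.neg_apply, Int.cast_neg]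
  linear_combination (2 * Real.pi * Complex.I) * h

lemma integral_mFourier_mul_rot {φ ψ : ℝ → ℂ} (hφ : Continuous φ) (hψ : Continuous ψ) (θ : ℝ)
    (n : Fin 2 → ℤ) :
    ∫ x, UnitAddTorus.mFourier (-n) (toTorus x) * (φ (rotFst θ x) * ψ (rotSnd θ x)) =
      𝓕 φ (rotFst θ (intVec n)) * 𝓕 ψ (rotSnd θ (intVec n)) := by
  simp only [mFourier_neg_toTorus θ, Real.fourier_real_eq_integral_exp_smul, smul_eq_mul]
  rw [← integral_rot (by fun_prop) (by fun_prop) θ]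
  refine integral_congr_ae (.of_forall fun x => ?_)
  ring

/-- **Poisson summation** for the rotated square lattice, which is its own dual. -/
theorem hasSum_fourier_mul_rot {φ ψ : ℝ → ℂ} (hφ : Continuous φ) (hψ : Continuous ψ)
    (hφd : HasDecay φ) (hψd : HasDecay ψ) (θ : ℝ)
    (hsum : Summable fun n : Fin 2 → ℤ =>
      𝓕 φ (rotFst θ (intVec n)) * 𝓕 ψ (rotSnd θ (intVec n))) :
    HasSum (fun n : Fin 2 → ℤ => 𝓕 φ (rotFst θ (intVec n)) * 𝓕 ψ (rotSnd θ (intVec n)))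
      (∑' n : Fin 2 → ℤ, φ (rotFst θ (intVec n)) * ψ (rotSnd θ (intVec n))) := by
  obtain ⟨C, hC0, hC⟩ := hφd.exists_nonneg
  obtain ⟨D, hD0, hD⟩ := hψd.exists_nonneg
  simp only [← integral_mFourier_mul_rot hφ hψ] at hsum ⊢
  exact hasSum_integral_mFourier (by fun_prop) (norm_mul_rot_le hC hD hC0 hD0 θ) hsum

/-- **Poisson summation** for the rotated square lattice, with inverse Fourier transforms. -/
theorem hasSum_fourierInv_mul_rot {φ ψ : ℝ → ℂ} (hφ : Continuous φ) (hψ : Continuous ψ)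
    (hφd : HasDecay φ) (hψd : HasDecay ψ) (θ : ℝ)
    (hsum : Summable fun n : Fin 2 → ℤ =>
      𝓕⁻ φ (rotFst θ (intVec n)) * 𝓕⁻ ψ (rotSnd θ (intVec n))) :
    HasSum (fun n : Fin 2 → ℤ => 𝓕⁻ φ (rotFst θ (intVec n)) * 𝓕⁻ ψ (rotSnd θ (intVec n)))
      (∑' n : Fin 2 → ℤ, φ (rotFst θ (intVec n)) * ψ (rotSnd θ (intVec n))) := by
  -- The inverse transform is the transform at the reflected point, and the lattice is symmetric.
  have key : (fun n : Fin 2 → ℤ => 𝓕⁻ φ (rotFst θ (intVec n)) * 𝓕⁻ ψ (rotSnd θ (intVec n))) =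
      (fun n => 𝓕 φ (rotFst θ (intVec n)) * 𝓕 ψ (rotSnd θ (intVec n))) ∘ Equiv.neg _ := by
    ext n
    simp [intVec_neg, rotFst_neg, rotSnd_neg, Real.fourierInv_eq_fourier_neg]
  rw [key] at hsum ⊢
  rw [Equiv.hasSum_iff]
  exact hasSum_fourier_mul_rot hφ hψ hφd hψd θ ((Equiv.neg _).summable_iff.1 hsum)

/-! ### Atomic measures and their variation. -/

section Atomic

variable {ι : Type*}

/-- The weights `c i` at the points `p i` are locally absolutely summable. -/
def LocallySummable (p : ι → ℝ) (c : ι → ℂ) : Prop :=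
  ∀ K : Set ℝ, IsCompact K → Summable ((p ⁻¹' K).indicator fun i => ‖c i‖)

lemma CompactlySupportedContinuousMap.norm_le_iSup (φ : C_c(ℝ, ℂ)) (x : ℝ) :
    ‖φ x‖ ≤ ⨆ x, ‖φ x‖ := by
  obtain ⟨C, hC⟩ := φ.continuous.bounded_above_of_compact_support φ.hasCompactSupport
  exact le_ciSup (f := fun x => ‖φ x‖) ⟨C, by rintro _ ⟨x, rfl⟩; exact hC x⟩ x

lemma norm_mul_le_indicator {p : ι → ℝ} (c : ι → ℂ) {f : ℝ → ℂ} {K : Set ℝ} {M : ℝ}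
    (hK : ∀ x, x ∉ K → f x = 0) (hM : ∀ x, ‖f x‖ ≤ M) (i : ι) :
    ‖f (p i) * c i‖ ≤ M * (p ⁻¹' K).indicator (fun i => ‖c i‖) i := by
  by_cases hi : p i ∈ K
  · rw [Set.indicator_of_mem (Set.mem_preimage.2 hi), norm_mul]
    exact mul_le_mul_of_nonneg_right (hM _) (norm_nonneg _)
  · have hi' : i ∉ p ⁻¹' K := hi
    simp [hi', hK _ hi]

namespace LocallySummable

variable {p : ι → ℝ} {c : ι → ℂ}

lemma summable_apply (hc : LocallySummable p c) (φ : C_c(ℝ, ℂ)) :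
    Summable fun i => φ (p i) * c i :=
  .of_norm_bounded ((hc _ φ.hasCompactSupport).mul_left (⨆ x, ‖φ x‖))
    (norm_mul_le_indicator c (fun _ => image_eq_zero_of_notMem_tsupport) φ.norm_le_iSup)

/-- The Radon measure `∑ c i δ_{p i}`. -/
noncomputable def toRadonMeasure (hc : LocallySummable p c) : RadonMeasure where
  val :=
    { toFun := fun φ => ∑' i, φ (p i) * c i
      map_add' := fun φ ψ => by
        rw [← (hc.summable_apply φ).tsum_add (hc.summable_apply ψ)]
        simp [add_mul]
      map_smul' := fun a φ => by simp [mul_assoc, tsum_mul_left] }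
  property := fun K hK => by
    refine ⟨∑' i, (p ⁻¹' K).indicator (fun i => ‖c i‖) i, fun φ hφ => ?_⟩
    rw [mul_comm, ← tsum_mul_left]
    exact tsum_of_norm_bounded ((hc K hK).mul_left _).hasSum
      (norm_mul_le_indicator c (fun _ hx => image_eq_zero_of_notMem_tsupport fun h => hx (hφ h))
        φ.norm_le_iSup)

end LocallySummable

namespace RadonMeasure

/-- The Radon measure `μ` is `∑ c i δ_{p i}`. -/
structure IsAtomic (μ : RadonMeasure) (p : ι → ℝ) (c : ι → ℂ) : Prop where
  locallySummable : LocallySummable p c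
  hasSum : ∀ φ : C_c(ℝ, ℂ), HasSum (fun i => φ (p i) * c i) (μ.1 φ)

end RadonMeasure

lemma LocallySummable.isAtomic_toRadonMeasure {p : ι → ℝ} {c : ι → ℂ} (hc : LocallySummable p c) :
    hc.toRadonMeasure.IsAtomic p c :=
  ⟨hc, fun φ => (hc.summable_apply φ).hasSum⟩

lemma RadonMeasure.IsAtomic.smul {μ : RadonMeasure} {p : ι → ℝ} {c : ι → ℂ}
    (h : μ.IsAtomic p c) (a : ℂ) : (a • μ).IsAtomic p (fun i => a * c i) where
  locallySummable := fun K hK => by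
    convert! (h.locallySummable K hK).mul_left ‖a‖ using 2 with i
    by_cases hi : i ∈ p ⁻¹' K <;> simp [hi]
  hasSum := fun φ => by
    convert! (h.hasSum φ).mul_left a using 2 with i
    ring

/-- The total weight of the atom at `a`. -/
noncomputable def atomWeight (p : ι → ℝ) (c : ι → ℂ) (a : ℝ) : ℂ := ∑' i : p ⁻¹' {a}, c i

/-- Distinct indices may carry the same point; the sum is regrouped along the fibres of `p`, on
which `f ∘ p` is constant. -/
lemma hasSum_mul_atomWeight {p : ι → ℝ} {c : ι → ℂ} {f : ℝ → ℂ} {z : ℂ}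
    (h : HasSum (fun i => f (p i) * c i) z) : HasSum (fun a => f a * atomWeight p c a) z := by
  refine (h.tsum_fiberwise p).congr_fun fun a => ?_
  rw [atomWeight, ← tsum_mul_left]
  exact tsum_congr fun i => by rw [show p i = a from i.2]

/-- The phase of the atom at `a`. -/
noncomputable def atomPhase (p : ι → ℝ) (c : ι → ℂ) (a : ℝ) : ℂ :=
  -- The value 1 off the atoms keeps the phase unimodular everywhere, as `HasIntegral` demands.
  if atomWeight p c a = 0 then 1 else atomWeight p c a / ‖atomWeight p c a‖

lemma norm_atomPhase (p : ι → ℝ) (c : ι → ℂ) (a : ℝ) : ‖atomPhase p c a‖ = 1 := by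
  unfold atomPhase
  split_ifs with h
  · exact norm_one
  · simp [h]

lemma norm_mul_atomPhase (p : ι → ℝ) (c : ι → ℂ) (a : ℝ) :
    ‖atomWeight p c a‖ * atomPhase p c a = atomWeight p c a := by
  unfold atomPhase
  split_ifs with h
  · simp [h]
  · exact mul_div_cancel₀ _ (by simpa using h)

/-- Off the countable range of `p` the fibre is empty and the phase is 1. -/
lemma measurable_atomPhase [Countable ι] (p : ι → ℝ) (c : ι → ℂ) : Measurable (atomPhase p c) := by
  refine Measurable.measurable_of_countable_ne (f := fun _ => (1 : ℂ)) measurable_const ?_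
  refine (Set.countable_range p).mono fun a ha => ?_
  by_contra hp
  apply ha
  have : IsEmpty (p ⁻¹' {a}) := ⟨fun i => hp ⟨i, i.2⟩⟩
  simp [atomPhase, atomWeight]

/-- The measure `∑ |w a| δ_a`, where `w a` is the weight of the atom at `a`. -/
noncomputable def atomVariation (p : ι → ℝ) (c : ι → ℂ) : Measure ℝ :=
  Measure.sum fun a => ‖atomWeight p c a‖ₑ • Measure.dirac a

lemma lintegral_atomVariation (p : ι → ℝ) (c : ι → ℂ) (f : ℝ → ℝ≥0∞) :
    ∫⁻ x, f x ∂atomVariation p c = ∑' a, ‖atomWeight p c a‖ₑ * f a := by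
  simp [atomVariation, lintegral_sum_measure]

/-- The triangle inequality on each fibre; it can be strict, since weights at a common point may
cancel. -/
lemma lintegral_atomVariation_le (p : ι → ℝ) (c : ι → ℂ) (f : ℝ → ℝ≥0∞) :
    ∫⁻ x, f x ∂atomVariation p c ≤ ∑' i, ‖c i‖ₑ * f (p i) := by
  rw [lintegral_atomVariation, ← ENNReal.tsum_fiberwise _ p]
  refine ENNReal.tsum_le_tsum fun a => ?_
  calc _ ≤ (∑' i : p ⁻¹' {a}, ‖c i‖ₑ) * f a := by gcongr; exact enorm_tsum_le_tsum_enorm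
    _ = _ := by
      rw [← ENNReal.tsum_mul_right]
      exact tsum_congr fun i => by rw [show p i = a from i.2]

lemma atomVariation_apply_le (p : ι → ℝ) (c : ι → ℂ) {S : Set ℝ} (hS : MeasurableSet S) :
    atomVariation p c S ≤ ∑' i, (p ⁻¹' S).indicator (fun i => ‖c i‖ₑ) i := by
  rw [← lintegral_indicator_one hS]
  refine (lintegral_atomVariation_le p c _).trans (ENNReal.tsum_le_tsum fun i => ?_)
  by_cases hi : p i ∈ S <;> simp [Set.indicator, hi]

lemma LocallySummable.atomVariation_lt_top {p : ι → ℝ} {c : ι → ℂ} (hc : LocallySummable p c)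
    {K : Set ℝ} (hK : IsCompact K) : atomVariation p c K < ∞ := by
  refine (atomVariation_apply_le p c hK.measurableSet).trans_lt ?_
  have h := (hc K hK).tsum_ofReal_lt_top
  convert h using 3 with i
  by_cases hi : i ∈ p ⁻¹' K <;> simp [hi]

lemma integrable_atomVariation {p : ι → ℝ} {c : ι → ℂ} {f : ℝ → ℂ} (hf : Measurable f)
    (hs : Summable fun i => ‖f (p i) * c i‖) : Integrable f (atomVariation p c) := by
  refine ⟨hf.aestronglyMeasurable, ?_⟩
  refine (lintegral_atomVariation_le p c _).trans_lt ?_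
  have h := hs.tsum_ofReal_lt_top
  convert h using 3 with i
  rw [ofReal_norm, enorm_mul, mul_comm]

lemma integral_atomVariation [Countable ι] {p : ι → ℝ} {c : ι → ℂ} {f : ℝ → ℂ} (hf : Measurable f)
    (hs : Summable fun i => ‖f (p i) * c i‖) :
    ∫ x, f x * atomPhase p c x ∂atomVariation p c = ∑' i, f (p i) * c i := by
  have hi : Integrable (fun x => f x * atomPhase p c x) (atomVariation p c) := by
    refine integrable_atomVariation (hf.mul (measurable_atomPhase p c)) ?_
    simpa [norm_atomPhase] using hs
  refine (hasSum_integral_measure hi).unique ?_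
  refine (hasSum_mul_atomWeight hs.of_norm.hasSum).congr_fun fun a => ?_
  rw [integral_smul_measure, integral_dirac, toReal_enorm, Complex.real_smul, mul_left_comm,
    norm_mul_atomPhase]

end Atomic

/-! ### Recovering atoms with tent functions, and the total variation of an atomic measure. -/

section Bump

/-- A tent function of height one and width `1 / (n + 1)` at `a`. -/
noncomputable def tent (a : ℝ) (n : ℕ) (x : ℝ) : ℝ := max 0 (1 - (n + 1) * |x - a|)

lemma continuous_tent (a : ℝ) (n : ℕ) : Continuous (tent a n) := by unfold tent; fun_prop

lemma tent_nonneg (a : ℝ) (n : ℕ) (x : ℝ) : 0 ≤ tent a n x := le_max_left _ _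

lemma tent_le_one (a : ℝ) (n : ℕ) (x : ℝ) : tent a n x ≤ 1 :=
  max_le zero_le_one (by linarith [(by positivity : 0 ≤ ((n : ℝ) + 1) * |x - a|)])

lemma tent_eq_zero {a : ℝ} (n : ℕ) {x : ℝ} (hx : x ∉ Metric.closedBall a 1) : tent a n x = 0 := by
  rw [Metric.mem_closedBall, Real.dist_eq, not_le] at hx
  have : (0 : ℝ) ≤ n * |x - a| := by positivity
  exact max_eq_left (by linarith)

/-- The tent function as a continuous function with compact support. -/
noncomputable def tentMap (a : ℝ) (n : ℕ) : C_c(ℝ, ℂ) where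
  toFun x := tent a n x
  continuous_toFun := Complex.continuous_ofReal.comp (continuous_tent a n)
  hasCompactSupport' := HasCompactSupport.intro (isCompact_closedBall a 1) fun x hx => by
    rw [tent_eq_zero n hx, Complex.ofReal_zero]

lemma tentMap_apply (a : ℝ) (n : ℕ) (x : ℝ) : tentMap a n x = tent a n x := rfl

lemma norm_tentMap_le_one (a : ℝ) (n : ℕ) (x : ℝ) : ‖tentMap a n x‖ ≤ 1 := by
  rw [tentMap_apply, Complex.norm_real, Real.norm_of_nonneg (tent_nonneg a n x)]
  exact tent_le_one a n x

lemma tendsto_tentMap (a x : ℝ) : Filter.Tendsto (fun n => tentMap a n x) Filter.atTop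
    (nhds (({a} : Set ℝ).indicator 1 x)) := by
  by_cases hx : x = a
  · simp [tentMap_apply, tent, hx]
  · refine tendsto_const_nhds.congr' ?_
    have h : 0 < |x - a| := abs_pos.2 (sub_ne_zero.2 hx)
    filter_upwards [(tendsto_natCast_atTop_atTop (R := ℝ)).eventually_ge_atTop |x - a|⁻¹] with n hn
    have h1 : 1 ≤ (n : ℝ) * |x - a| := by rwa [← inv_le_iff_one_le_mul₀ h]
    rw [tentMap_apply, tent, max_eq_left (by linarith)]
    simp [hx]

end Bump

namespace RadonMeasure.IsAtomic

variable {ι : Type*} {μ : RadonMeasure} {p : ι → ℝ} {c : ι → ℂ}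

/-- Dominated convergence along tents shrinking to `a`. Thus atom weights depend on `μ` alone, which
allows them to be compared with any majorant of `μ`. -/
lemma tendsto_tentMap (h : μ.IsAtomic p c) (a : ℝ) :
    Filter.Tendsto (fun n => μ.1 (tentMap a n)) Filter.atTop (nhds (atomWeight p c a)) := by
  have h1 : atomWeight p c a = ∑' i, ({a} : Set ℝ).indicator 1 (p i) * c i := by
    rw [atomWeight, tsum_subtype (p ⁻¹' {a}) c]
    refine tsum_congr fun i => ?_
    by_cases hi : p i = a <;> simp [Set.indicator, hi]
  simp only [h1, ← (h.hasSum _).tsum_eq]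
  refine tendsto_tsum_of_dominated_convergence
    ((h.locallySummable _ (isCompact_closedBall a 1)).mul_left 1)
    (fun i => (_root_.tendsto_tentMap a (p i)).mul_const _) (.of_forall fun n i => ?_)
  exact norm_mul_le_indicator c (fun x hx => by rw [tentMap_apply, tent_eq_zero n hx]; simp)
    (norm_tentMap_le_one a n) i

lemma atomWeight_eq_zero (h : μ.IsAtomic p c) (h0 : μ = 0) (a : ℝ) : atomWeight p c a = 0 := by
  refine tendsto_nhds_unique (h.tendsto_tentMap a) ?_
  simp [h0]

lemma enorm_atomWeight_le (h : μ.IsAtomic p c) {ν : Measure ℝ} [IsLocallyFiniteMeasure ν]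
    (hν : ∀ φ : C_c(ℝ, ℂ), ‖μ.1 φ‖ₑ ≤ ∫⁻ x, ‖φ x‖ₑ ∂ν) (a : ℝ) :
    ‖atomWeight p c a‖ₑ ≤ ν {a} := by
  have hlim : Filter.Tendsto (fun n => ∫⁻ x, ‖tentMap a n x‖ₑ ∂ν) Filter.atTop
      (nhds (∫⁻ x, ({a} : Set ℝ).indicator 1 x ∂ν)) := by
    refine tendsto_lintegral_of_dominated_convergence ((Metric.closedBall a 1).indicator 1)
      (fun n => (tentMap a n).continuous.enorm.measurable) (fun n => .of_forall fun x => ?_) ?_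
      (.of_forall fun x => ?_)
    · by_cases hx : x ∈ Metric.closedBall a 1
      · beta_reduce
        rw [Set.indicator_of_mem hx, Pi.one_apply, ← ofReal_norm, ← ENNReal.ofReal_one]
        exact ENNReal.ofReal_le_ofReal (norm_tentMap_le_one a n x)
      · simp [tentMap_apply, tent_eq_zero n hx]
    · rw [lintegral_indicator_one Metric.isClosed_closedBall.measurableSet]
      exact (isCompact_closedBall a 1).measure_lt_top.ne
    · convert! (_root_.tendsto_tentMap a x).enorm using 2
      by_cases hx : x = a <;> simp [hx]
  rw [lintegral_indicator_one (measurableSet_singleton a)] at hlim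
  exact le_of_tendsto_of_tendsto' (h.tendsto_tentMap a).enorm hlim fun n => hν _

variable [Countable ι]

lemma apply_eq_integral (h : μ.IsAtomic p c) (φ : C_c(ℝ, ℂ)) :
    μ.1 φ = ∫ x, φ x * atomPhase p c x ∂atomVariation p c := by
  exact (h.hasSum φ).tsum_eq.symm.trans (integral_atomVariation (f := φ) φ.continuous.measurable
    (h.hasSum φ).summable.norm).symm

lemma totalVariation_eq (h : μ.IsAtomic p c) : μ.totalVariation = atomVariation p c := by
  refine le_antisymm (sInf_le ⟨?_, fun φ => ?_⟩) (le_sInf fun ν hν => ?_)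
  · exact ⟨fun x => ⟨_, Metric.closedBall_mem_nhds x one_pos,
      h.locallySummable.atomVariation_lt_top (isCompact_closedBall x 1)⟩⟩
  · rw [h.apply_eq_integral]
    refine (enorm_integral_le_lintegral_enorm _).trans (lintegral_mono fun x => ?_)
    rw [enorm_mul, ← ofReal_norm (atomPhase p c x), norm_atomPhase]
    simp
  -- Minimality: a majorant dominates each atom, and the singletons are disjoint. The index set is
  -- uncountable, but only the inequality from sum to union is needed.
  · have := hν.1
    refine Measure.le_iff.2 fun S hS => ?_
    rw [← lintegral_indicator_one hS, lintegral_atomVariation]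
    calc _ ≤ ∑' a, ν (S ∩ {a}) := ENNReal.tsum_le_tsum fun a => ?_
      _ ≤ ν (⋃ a, S ∩ {a}) := tsum_meas_le_meas_iUnion_of_disjoint _
          (fun a => hS.inter (measurableSet_singleton a)) fun a b hab =>
            (Set.disjoint_singleton.2 hab).mono Set.inter_subset_right Set.inter_subset_right
      _ ≤ ν S := measure_mono (Set.iUnion_subset fun _ => Set.inter_subset_left)
    by_cases ha : a ∈ S
    · rw [Set.indicator_of_mem ha, Set.inter_eq_right.2 (Set.singleton_subset_iff.2 ha)]
      simpa using h.enorm_atomWeight_le hν.2 a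
    · simp [ha]

lemma hasIntegral (h : μ.IsAtomic p c) {f : ℝ → ℂ} {z : ℂ} (hf : Measurable f)
    (hs : HasSum (fun i => f (p i) * c i) z) : μ.HasIntegral f z := by
  rw [RadonMeasure.HasIntegral, h.totalVariation_eq]
  exact ⟨integrable_atomVariation hf hs.summable.norm, atomPhase p c, measurable_atomPhase p c,
    norm_atomPhase p c, h.apply_eq_integral,
    (integral_atomVariation hf hs.summable.norm).trans hs.tsum_eq⟩

lemma translationBounded (h : μ.IsAtomic p c)
    (hb : ∀ K : Set ℝ, IsCompact K → ∃ C : ℝ, ∀ t : ℝ,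
      ∑' i, (p ⁻¹' ((fun x => t + x) '' K)).indicator (fun i => ‖c i‖) i ≤ C) :
    μ.TranslationBounded := by
  intro K hK
  obtain ⟨C, hC⟩ := hb K hK
  refine (iSup_le fun t => ?_).trans_lt (ENNReal.ofReal_lt_top (r := C))
  have hKt : IsCompact ((fun x => t + x) '' K) := hK.image (by fun_prop)
  rw [h.totalVariation_eq]
  refine (atomVariation_apply_le p c hKt.measurableSet).trans ?_
  refine le_trans (le_of_eq ?_) (ENNReal.ofReal_le_ofReal (hC t))
  rw [ENNReal.ofReal_tsum_of_nonneg (fun i => Set.indicator_nonneg (fun _ _ => norm_nonneg _) i)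
    (h.locallySummable _ hKt)]
  refine tsum_congr fun i => ?_
  by_cases hi : i ∈ p ⁻¹' ((fun x => t + x) '' K)
  · rw [Set.indicator_of_mem hi, Set.indicator_of_mem hi, ofReal_norm]
  · rw [Set.indicator_of_notMem hi, Set.indicator_of_notMem hi, ENNReal.ofReal_zero]

end RadonMeasure.IsAtomic

/-! ### Fourier transforms of compactly supported functions. -/

lemma integral_fourier_mul_eq_of_integrable {f g : ℝ → ℂ} (hf : Integrable f) (hg : Integrable g) :
    ∫ x, 𝓕 f x * g x = ∫ x, f x * 𝓕 g x := by
  simpa using! (VectorFourier.integral_fourierIntegral_smul_eq_flip (L := innerₗ ℝ)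
    Real.continuous_fourierChar continuous_inner hf hg)

lemma continuous_fourier_of_integrable {f : ℝ → ℂ} (hf : Integrable f) : Continuous (𝓕 f) :=
  VectorFourier.fourierIntegral_continuous Real.continuous_fourierChar continuous_inner hf

/-- The Fourier transform of an integrable and square integrable function is square integrable. -/
lemma memLp_two_fourier {f : ℝ → ℂ} (hf : Integrable f) (hf2 : MemLp f 2) : MemLp (𝓕 f) 2 := by
  set G : Lp ℂ 2 (volume : Measure ℝ) := 𝓕 (hf2.toLp f)
  have hG : MemLp G 2 := Lp.memLp G
  refine hG.ae_eq ?_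
  -- The `L²` transform `G` is identified with the integral transform by testing: distributional
  -- duality moves the transform onto the test function, and the multiplication formula moves it
  -- back onto `f`.
  refine ae_eq_of_integral_contDiff_smul_eq (hG.locallyIntegrable (by norm_num))
    (continuous_fourier_of_integrable hf).locallyIntegrable fun χ hχ hχs => ?_
  have hχs' : HasCompactSupport fun x => (χ x : ℂ) := hχs.comp_left (g := fun r : ℝ => (r : ℂ)) rfl
  let ψ : 𝓢(ℝ, ℂ) := hχs'.toSchwartzMap (Complex.ofRealCLM.contDiff.comp hχ)
  have hψ : ∀ x, ψ x = χ x := fun x => rfl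
  have h1 : ∫ x, ψ x • G x = ∫ x, (𝓕 ψ) x • (hf2.toLp f) x := by
    rw [← Lp.toTemperedDistribution_apply, ← Lp.toTemperedDistribution_apply,
      ← TemperedDistribution.fourier_apply, Lp.fourier_toTemperedDistribution_eq]
  have h2 : ∫ x, (𝓕 ψ) x • (hf2.toLp f) x = ∫ x, (𝓕 ψ) x * f x :=
    integral_congr_ae (hf2.coeFn_toLp.mono fun x hx => by simp [hx])
  rw [SchwartzMap.fourier_coe, integral_fourier_mul_eq_of_integrable ψ.integrable hf] at h2
  simpa [hψ] using h1.trans h2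

lemma fourier_comp_sub (f : ℝ → ℂ) (a w : ℝ) :
    𝓕 (fun x => f (x - a)) w =
      Complex.exp (((-2 * Real.pi * a * w : ℝ) : ℂ) * Complex.I) * 𝓕 f w := by
  rw [Real.fourier_real_eq_integral_exp_smul, Real.fourier_real_eq_integral_exp_smul,
    ← integral_add_right_eq_self _ a, ← integral_const_mul]
  refine integral_congr_ae (.of_forall fun x => ?_)
  simp only [add_sub_cancel_right, smul_eq_mul]
  rw [← mul_assoc, ← Complex.exp_add]
  congr 2
  push_cast
  ring

/-- The Fourier transform of a compactly supported function reproduces itself by convolution with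
a Schwartz function. -/
lemma exists_schwartz_reproducing {A : ℝ → ℂ} (hAc : Continuous A) (hAs : HasCompactSupport A) :
    ∃ η : 𝓢(ℝ, ℂ), ∀ x, 𝓕 A x = ∫ s, 𝓕 A s * η (s - x) := by
  obtain ⟨R, hR⟩ := hAs.isBounded.subset_closedBall 0
  -- A bump equal to 1 on the support of `A`; the maximum with 1 only keeps the radius positive.
  let b : ContDiffBump (0 : ℝ) := ⟨max R 1, max R 1 + 1, by positivity, by linarith⟩
  have hbs : HasCompactSupport fun x => (b x : ℂ) :=
    b.hasCompactSupport.comp_left (g := fun r : ℝ => (r : ℂ)) rfl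
  let χ : 𝓢(ℝ, ℂ) := hbs.toSchwartzMap (Complex.ofRealCLM.contDiff.comp b.contDiff)
  have hχ : ∀ x, A x * χ x = A x := fun x => by
    by_cases hx : x ∈ tsupport A
    · have : b x = 1 := b.one_of_mem_closedBall
        (Metric.closedBall_subset_closedBall (le_max_left R 1) (hR hx))
      change A x * (b x : ℂ) = A x
      rw [this, Complex.ofReal_one, mul_one]
    · rw [image_eq_zero_of_notMem_tsupport hx, zero_mul]
  -- By the multiplication formula the convolution is the transform of `A * χ = A`.
  refine ⟨𝓕⁻ χ, fun x => ?_⟩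
  have hη : 𝓕 (𝓕⁻ χ : 𝓢(ℝ, ℂ)) = (χ : 𝓢(ℝ, ℂ)) := FourierTransform.fourier_fourierInv_eq χ
  have hA : Integrable A := hAc.integrable_of_hasCompactSupport hAs
  rw [integral_fourier_mul_eq_of_integrable hA ((𝓕⁻ χ).integrable.comp_sub_right x),
    Real.fourier_real_eq_integral_exp_smul]
  refine integral_congr_ae (.of_forall fun y => ?_)
  beta_reduce
  rw [fourier_comp_sub, ← SchwartzMap.fourier_coe, hη, smul_eq_mul]
  rw [mul_left_comm, hχ]
  congr 3
  push_cast
  ring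

/-- No pointwise decay of `𝓕 A` is available. The reproducing formula bounds each term by an
integral of `|𝓕 A(s)|` against `planeKernel` translated by `s` along the first rotated axis; the
lattice sum of the kernel is bounded uniformly in `s`, so integrability of `𝓕 A` suffices. -/
lemma summable_norm_fourier_mul_rot {A : ℝ → ℂ} (hAc : Continuous A)
    (hAs : HasCompactSupport A) (hA : Integrable (𝓕 A)) {ψ : ℝ → ℂ}
    (hψ : HasDecay ψ) (θ : ℝ) :
    Summable fun n : Fin 2 → ℤ => ‖𝓕 A (rotFst θ (intVec n)) * ψ (rotSnd θ (intVec n))‖ := by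
  obtain ⟨η, hη⟩ := exists_schwartz_reproducing hAc hAs
  obtain ⟨C, hC0, hC⟩ := η.hasDecay.exists_nonneg
  obtain ⟨D, hD0, hD⟩ := hψ.exists_nonneg
  have hint : ∀ n : Fin 2 → ℤ,
      Integrable fun s => ‖𝓕 A s‖ * planeKernel (intVec n - rotInvFst θ s) := fun n => by
    refine hA.norm.mul_bdd (c := 1) (Continuous.aestronglyMeasurable ?_) (.of_forall fun s => ?_)
    · unfold planeKernel rotInvFst
      have := continuous_decayKernel
      simp only [Pi.sub_apply, Matrix.cons_val_zero, Matrix.cons_val_one]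
      fun_prop
    · rw [Real.norm_of_nonneg (planeKernel_pos _).le]
      exact mul_le_one₀ (decayKernel_le_one _) (decayKernel_pos _).le (decayKernel_le_one _)
  have hterm : ∀ n : Fin 2 → ℤ, ‖𝓕 A (rotFst θ (intVec n)) * ψ (rotSnd θ (intVec n))‖ ≤
      C * D * ∫ s, ‖𝓕 A s‖ * planeKernel (intVec n - rotInvFst θ s) := fun n => by
    rw [hη, ← integral_mul_const, ← integral_const_mul]
    refine norm_integral_le_of_norm_le ((hint n).const_mul _) (.of_forall fun s => ?_)
    -- The reflection accounts for the argument `s - x` in the reproducing formula; the decay kernel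
    -- is even.
    have h := norm_mul_rot_le (φ := fun u => η (-u)) (fun u => by
      simpa [decayKernel] using hC (-u)) hD hC0 hD0 θ (intVec n - rotInvFst θ s)
    rw [rotFst_sub_rotInvFst, rotSnd_sub_rotInvFst, neg_sub] at h
    rw [mul_assoc, norm_mul, mul_left_comm]
    exact mul_le_mul_of_nonneg_left h (norm_nonneg _)
  refine .of_nonneg_of_le (fun _ => norm_nonneg _) hterm (.mul_left _ ?_)
  refine summable_of_sum_le (c := ∫ s, ‖𝓕 A s‖ * planeKernelBound)
    (fun n => integral_nonneg fun s => mul_nonneg (norm_nonneg _) (planeKernel_pos _).le) fun S => ?_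
  rw [← integral_finsetSum _ fun n _ => hint n]
  refine integral_mono (integrable_finsetSum _ fun n _ => hint n) (hA.norm.mul_const _) fun s => ?_
  beta_reduce
  rw [← Finset.mul_sum]
  refine mul_le_mul_of_nonneg_left ?_ (norm_nonneg _)
  exact ((hasSum_planeKernel_intVec_sub _).summable.sum_le_tsum S
    fun n _ => (planeKernel_pos _).le).trans (tsum_planeKernel_intVec_sub_le _)

lemma fourier_conj_neg (f : ℝ → ℂ) (w : ℝ) : 𝓕 (fun x => conj (f (-x))) w = conj (𝓕 f w) := by
  rw [Real.fourier_real_eq_integral_exp_smul, Real.fourier_real_eq_integral_exp_smul,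
    ← integral_conj, ← integral_neg_eq_self]
  refine integral_congr_ae (.of_forall fun x => ?_)
  simp only [smul_eq_mul, neg_neg, map_mul, ← Complex.exp_conj, Complex.conj_I, Complex.conj_ofReal]
  congr 2
  push_cast
  ring

lemma fourier_autocorrelation (f : C_c(ℝ, ℂ)) (w : ℝ) :
    𝓕 (autocorrelation f : ℝ → ℂ) w = ((‖𝓕 (f : ℝ → ℂ) w‖ ^ 2 : ℝ) : ℂ) := by
  have hf : Integrable f := f.continuous.integrable_of_hasCompactSupport f.hasCompactSupport
  have hf' : Integrable fun x => conj (f (-x)) :=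
    (Complex.conjLIE.integrable_comp_iff (φ := fun x => f (-x))).2 hf.comp_neg
  -- Passes from real-bilinear to complex-bilinear multiplication, the form used by the convolution
  -- theorem.
  have h : (autocorrelation f : ℝ → ℂ) =
      (f : ℝ → ℂ) ⋆[ContinuousLinearMap.mul ℂ ℂ] (fun x => conj (f (-x))) := rfl
  rw [h, Real.fourier_mul_convolution_eq hf hf', fourier_conj_neg, Complex.mul_conj,
    Complex.normSq_eq_norm_sq]

/-- The transform is `|𝓕 f|²`, and `𝓕 f` is square integrable because `f` lies in `L¹ ∩ L²`. -/
lemma integrable_fourier_autocorrelation (f : C_c(ℝ, ℂ)) :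
    Integrable (𝓕 (autocorrelation f : ℝ → ℂ)) := by
  have hf : Integrable f := f.continuous.integrable_of_hasCompactSupport f.hasCompactSupport
  have hf2 : MemLp f 2 := f.continuous.memLp_of_hasCompactSupport f.hasCompactSupport
  have h := (memLp_two_fourier hf hf2).integrable_norm_pow two_ne_zero
  rw [funext (fourier_autocorrelation f)]
  exact h.ofReal

/-! ### The lattice measure and its tempered distribution. -/

section Lattice

variable (θ : ℝ)

lemma rotatedBasis_combination (n : Fin 2 → ℤ) :
    ∑ i, n i • (rotatedBasis θ).col i = ![rotFst θ (intVec n), rotSnd θ (intVec n)] := by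
  ext i
  fin_cases i <;> simp [rotatedBasis, rotFst, rotSnd, intVec, Matrix.col] <;> ring

lemma eq_of_rot_eq {x y : Fin 2 → ℝ} (h0 : rotFst θ x = rotFst θ y) (h1 : rotSnd θ x = rotSnd θ y) :
    x = y := by
  have h := rotFst_mul_add_rotSnd_mul θ (x - y) (x - y)
  have e0 : rotFst θ (x - y) = 0 := by rw [← sub_eq_zero.2 h0]; simp [rotFst]; ring
  have e1 : rotSnd θ (x - y) = 0 := by rw [← sub_eq_zero.2 h1]; simp [rotSnd]; ring
  simp only [e0, e1, Pi.sub_apply] at h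
  ext i
  fin_cases i
  · exact sub_eq_zero.1 (by simp; nlinarith [sq_nonneg (x 0 - y 0), sq_nonneg (x 1 - y 1)])
  · exact sub_eq_zero.1 (by simp; nlinarith [sq_nonneg (x 0 - y 0), sq_nonneg (x 1 - y 1)])

lemma intVec_injective : Function.Injective intVec := fun m n h => by
  ext i
  exact Int.cast_injective (congrFun h i)

/-- The points of the rotated lattice are parametrized by `ℤ²`. -/
noncomputable def latticeEquiv : (Fin 2 → ℤ) ≃ rotatedLattice θ :=
  Equiv.ofBijective
    (fun n => ⟨![rotFst θ (intVec n), rotSnd θ (intVec n)],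
      (Submodule.mem_span_range_iff_exists_fun ℤ).2 ⟨n, rotatedBasis_combination θ n⟩⟩) <| by
    constructor
    · intro m n h
      have h := Subtype.ext_iff.1 h
      exact intVec_injective (eq_of_rot_eq θ (congrFun h 0) (congrFun h 1))
    · rintro ⟨z, hz⟩
      obtain ⟨n, rfl⟩ := (Submodule.mem_span_range_iff_exists_fun ℤ).1 hz
      exact ⟨n, Subtype.ext (rotatedBasis_combination θ n).symm⟩

lemma hasSum_rotatedLattice_iff {φ ψ : ℝ → ℂ} {s : ℂ} :
    HasSum (fun z : rotatedLattice θ => φ (z.1 0) * ψ (z.1 1)) s ↔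
      HasSum (fun n : Fin 2 → ℤ => φ (rotFst θ (intVec n)) * ψ (rotSnd θ (intVec n))) s :=
  (latticeEquiv θ).hasSum_iff.symm

end Lattice

section LatticeMeasure

variable (θ : ℝ) {ψ : ℝ → ℂ}

/-- Translating by `t` along the first rotated axis reduces to a bounded first coordinate, where the
indicator is at most a multiple of the kernel. Uniformity in `t` is inherited from
`planeKernelBound`. -/
lemma exists_tsum_indicator_le (hψ : HasDecay ψ) {K : Set ℝ} (hK : IsCompact K) :
    ∃ C : ℝ, ∀ t : ℝ,
      Summable (((fun n => rotFst θ (intVec n)) ⁻¹' ((fun x => t + x) '' K)).indicator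
        fun n : Fin 2 → ℤ => ‖ψ (rotSnd θ (intVec n))‖) ∧
      ∑' n, ((fun n => rotFst θ (intVec n)) ⁻¹' ((fun x => t + x) '' K)).indicator
        (fun n : Fin 2 → ℤ => ‖ψ (rotSnd θ (intVec n))‖) n ≤ C := by
  obtain ⟨R, hR⟩ := hK.isBounded.subset_closedBall 0
  obtain ⟨D, hD0, hD⟩ := hψ.exists_nonneg
  -- The factor `(1 + R²)²` compensates `decayKernel x ^ 2` for `|x| ≤ R`, and `D` is the decay
  -- constant of `ψ`.
  set M := (1 + R ^ 2) ^ 2 * D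
  have hM : 0 ≤ M := by positivity
  have hle : ∀ (t : ℝ) (n : Fin 2 → ℤ),
      ((fun n => rotFst θ (intVec n)) ⁻¹' ((fun x => t + x) '' K)).indicator
        (fun n : Fin 2 → ℤ => ‖ψ (rotSnd θ (intVec n))‖) n ≤
      M * planeKernel (intVec n - rotInvFst θ t) := fun t n => by
    refine Set.indicator_apply_le' ?_ fun _ => mul_nonneg hM (planeKernel_pos _).le
    rintro ⟨x, hx, hxt⟩
    have hx' : x = rotFst θ (intVec n) - t := by linarith [hxt]
    have hxR : x ^ 2 ≤ R ^ 2 := by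
      have := hR hx
      rw [mem_closedBall_zero_iff, Real.norm_eq_abs] at this
      exact sq_le_sq' (by linarith [neg_abs_le x]) ((le_abs_self x).trans this)
    have h1 : 1 ≤ (1 + R ^ 2) ^ 2 * decayKernel x ^ 2 := by
      rw [decayKernel, inv_pow, ← div_eq_mul_inv, one_le_div (by positivity)]
      gcongr
    have h2 := decayKernel_rot_le θ (intVec n - rotInvFst θ t)
    rw [rotFst_sub_rotInvFst, rotSnd_sub_rotInvFst, ← hx'] at h2
    set k := decayKernel (rotSnd θ (intVec n)) ^ 2
    have hk : 0 ≤ k := sq_nonneg _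
    calc ‖ψ (rotSnd θ (intVec n))‖ ≤ 1 * (D * k) := by rw [one_mul]; exact hD _
      _ ≤ ((1 + R ^ 2) ^ 2 * decayKernel x ^ 2) * (D * k) := by gcongr
      _ = M * (decayKernel x ^ 2 * k) := by ring
      _ ≤ _ := by gcongr
  refine ⟨M * planeKernelBound, fun t => ?_⟩
  have hs := (hasSum_planeKernel_intVec_sub (rotInvFst θ t)).summable.mul_left M
  have hs' := Summable.of_nonneg_of_le (fun n => Set.indicator_nonneg
    (fun _ _ => norm_nonneg _) n) (hle t) hs
  refine ⟨hs', (hs'.tsum_le_tsum (hle t) hs).trans ?_⟩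
  rw [tsum_mul_left]
  exact mul_le_mul_of_nonneg_left (tsum_planeKernel_intVec_sub_le _) hM

lemma locallySummable_rot (hψ : HasDecay ψ) :
    LocallySummable (fun n : Fin 2 → ℤ => rotFst θ (intVec n))
      (fun n => ψ (rotSnd θ (intVec n))) := fun K hK => by
  obtain ⟨C, hC⟩ := exists_tsum_indicator_le θ hψ hK
  simpa using (hC 0).1

/-- The measure `φ ↦ ∑ φ(x) ψ(y)`, the sum being over the points `(x, y)` of the rotated lattice. -/
noncomputable def latticeMeasure (hψ : HasDecay ψ) : RadonMeasure :=
  (locallySummable_rot θ hψ).toRadonMeasure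

lemma isAtomic_latticeMeasure (hψ : HasDecay ψ) :
    (latticeMeasure θ hψ).IsAtomic (fun n : Fin 2 → ℤ => rotFst θ (intVec n))
      (fun n => ψ (rotSnd θ (intVec n))) :=
  (locallySummable_rot θ hψ).isAtomic_toRadonMeasure

lemma translationBounded_latticeMeasure (hψ : HasDecay ψ) :
    (latticeMeasure θ hψ).TranslationBounded :=
  (isAtomic_latticeMeasure θ hψ).translationBounded fun _ hK =>
    (exists_tsum_indicator_le θ hψ hK).imp fun _ hC t => (hC t).2

/-- The tempered distribution `φ ↦ ∑ φ(x) ψ(y)`, the sum being over the points `(x, y)` of the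
rotated lattice. -/
noncomputable def latticeDistribution (hψ : HasDecay ψ) : 𝓢'(ℝ, ℂ) :=
  ContinuousLinearMap.toPointwiseConvergenceCLM _ _ _ _ <|
    SchwartzMap.mkCLMtoNormedSpace (σ := RingHom.id ℂ)
      (fun φ : 𝓢(ℝ, ℂ) =>
        ∑' n : Fin 2 → ℤ, φ (rotFst θ (intVec n)) * ψ (rotSnd θ (intVec n)))
      (fun φ χ => by
        rw [← (summable_norm_mul_rot φ.hasDecay hψ θ).of_norm.tsum_add
          (summable_norm_mul_rot χ.hasDecay hψ θ).of_norm]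
        simp [add_mul])
      (fun a φ => by simp [mul_assoc, tsum_mul_left]) <| by
        obtain ⟨D, hD0, hD⟩ := hψ.exists_nonneg
        refine ⟨Finset.Iic (4, 0), 2 ^ 4 * (D * ∑' n : Fin 2 → ℤ, planeKernel (intVec n)),
          mul_nonneg (by norm_num) (mul_nonneg hD0 (tsum_nonneg fun n => (planeKernel_pos _).le)),
          fun φ => ?_⟩
        refine (tsum_of_norm_bounded (summable_planeKernel_intVec.mul_left _).hasSum
          fun n => norm_mul_rot_le φ.norm_le_decaySeminorm hD
            (mul_nonneg (by norm_num) (apply_nonneg _ _)) hD0 θ (intVec n)).trans (le_of_eq ?_)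
        rw [tsum_mul_left, decaySeminorm]
        ring

lemma hasSum_latticeDistribution (hψ : HasDecay ψ) (φ : 𝓢(ℝ, ℂ)) :
    HasSum (fun n : Fin 2 → ℤ => φ (rotFst θ (intVec n)) * ψ (rotSnd θ (intVec n)))
      (latticeDistribution θ hψ φ) :=
  (summable_norm_mul_rot φ.hasDecay hψ θ).of_norm.hasSum

lemma isRepresentedBy_latticeDistribution (hψ : HasDecay ψ) :
    (latticeMeasure θ hψ).IsRepresentedBy (latticeDistribution θ hψ) := fun _ _ => rfl

end LatticeMeasure

/-! ### The eigenvalue equation, distributional and strict. -/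

section Eigenfunction

variable {g : 𝓢(ℝ, ℂ)} {lam : ℂ}

/-- Fourier inversion gives `lam² g(-x) = g(x)`; applying this twice yields `lam⁴ = 1`. -/
lemma norm_fourier_eigenvalue (hg : g ≠ 0) (hlam : 𝓕 g = lam • g) : ‖lam‖ = 1 := by
  have h1 : ∀ x, lam * (lam * g (-x)) = g x := fun x => by
    have h : 𝓕⁻ (𝓕 g) = g := FourierTransform.fourierInv_fourier_eq g
    rw [hlam, FourierTransform.fourierInv_smul] at h
    have h2 : (𝓕⁻ g) x = lam * g (-x) := by
      rw [SchwartzMap.fourierInv_coe, Real.fourierInv_eq_fourier_neg, ← SchwartzMap.fourier_coe,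
        hlam]
      rfl
    rw [← h2]
    exact DFunLike.congr_fun h x
  obtain ⟨x, hx⟩ : ∃ x, g x ≠ 0 := by
    by_contra! h
    exact hg (SchwartzMap.ext h)
  have h4 : lam ^ 4 = 1 := by
    have h2 := h1 (-x)
    rw [neg_neg] at h2
    refine mul_right_cancel₀ hx ?_
    linear_combination lam ^ 2 * h2 + h1 x
  exact (pow_eq_one_iff_of_nonneg (norm_nonneg _) four_ne_zero).1 (by rw [← norm_pow, h4, norm_one])

/-- Inversion gives the factor `lam⁻¹`, which is `conj lam` on the unit circle; hence the conjugate
in the eigenvalue of the measure. -/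
lemma fourierInv_eigenfunction (hg : g ≠ 0) (hlam : 𝓕 g = lam • g) (x : ℝ) :
    𝓕⁻ (g : ℝ → ℂ) x = conj lam * g x := by
  have h1 := norm_fourier_eigenvalue hg hlam
  have h0 : lam ≠ 0 := norm_ne_zero_iff.1 (by rw [h1]; exact one_ne_zero)
  have h : 𝓕⁻ (𝓕 g) = g := FourierTransform.fourierInv_fourier_eq g
  rw [hlam, FourierTransform.fourierInv_smul] at h
  have h2 : lam * 𝓕⁻ (g : ℝ → ℂ) x = g x := by
    rw [← SchwartzMap.fourierInv_coe]
    exact DFunLike.congr_fun h x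
  rw [← Complex.inv_eq_conj h1, ← h2, inv_mul_cancel_left₀ h0]

variable (θ : ℝ)

/-- Poisson summation for the pair `𝓕 φ`, `g`. -/
lemma hasFourierTransform_latticeMeasure (hg : g ≠ 0) (hlam : 𝓕 g = lam • g) :
    (latticeMeasure θ g.hasDecay).HasFourierTransform
      (conj lam • latticeMeasure θ g.hasDecay) := by
  refine ⟨latticeDistribution θ g.hasDecay, isRepresentedBy_latticeDistribution θ _,
    fun φ hφ => ?_⟩
  have hinv : ∀ x, 𝓕⁻ ((𝓕 φ : 𝓢(ℝ, ℂ)) : ℝ → ℂ) x = φ x := fun x => by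
    rw [← SchwartzMap.fourierInv_coe, FourierTransform.fourierInv_fourier_eq]
  have hs := (((isAtomic_latticeMeasure θ g.hasDecay).smul (conj lam)).hasSum
    ⟨⟨φ, φ.continuous⟩, hφ⟩)
  have key : (fun n : Fin 2 → ℤ => φ (rotFst θ (intVec n)) *
      (conj lam * g (rotSnd θ (intVec n)))) = fun n =>
      𝓕⁻ ((𝓕 φ : 𝓢(ℝ, ℂ)) : ℝ → ℂ) (rotFst θ (intVec n)) *
        𝓕⁻ (g : ℝ → ℂ) (rotSnd θ (intVec n)) := by
    simp only [hinv, fourierInv_eigenfunction hg hlam]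
  change HasSum (fun n : Fin 2 → ℤ => φ (rotFst θ (intVec n)) *
      (conj lam * g (rotSnd θ (intVec n)))) _ at hs
  rw [key] at hs
  rw [TemperedDistribution.fourier_apply,
    ← (hasSum_latticeDistribution θ g.hasDecay (𝓕 φ)).tsum_eq]
  exact (hasSum_fourierInv_mul_rot (𝓕 φ).continuous g.continuous (𝓕 φ).hasDecay g.hasDecay θ
    hs.summable).unique hs

/-- Poisson summation for the pair `f * f̃`, `g`; summability on the transform side is the delicate
hypothesis. -/
lemma hasStrictFourierTransform_latticeMeasure (hg : g ≠ 0) (hlam : 𝓕 g = lam • g) :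
    (latticeMeasure θ g.hasDecay).HasStrictFourierTransform
      (conj lam • latticeMeasure θ g.hasDecay) := by
  intro f
  have hinv : ∀ x, 𝓕⁻ (autocorrelation f : ℝ → ℂ) x = ((‖𝓕⁻ (f : ℝ → ℂ) x‖ ^ 2 : ℝ) : ℂ) :=
    fun x => by
      rw [Real.fourierInv_eq_fourier_neg, fourier_autocorrelation, ← Real.fourierInv_eq_fourier_neg]
  have hf : Integrable (f : ℝ → ℂ) :=
    f.continuous.integrable_of_hasCompactSupport f.hasCompactSupport
  have hcont : Continuous fun x => ((‖𝓕⁻ (f : ℝ → ℂ) x‖ ^ 2 : ℝ) : ℂ) := by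
    have := continuous_fourier_of_integrable hf
    simp only [Real.fourierInv_eq_fourier_neg]
    fun_prop
  have hA : Continuous (autocorrelation f : ℝ → ℂ) := (autocorrelation f).continuous
  have hAs : HasCompactSupport (autocorrelation f : ℝ → ℂ) := (autocorrelation f).hasCompactSupport
  have hsum : Summable fun n : Fin 2 → ℤ =>
      𝓕⁻ (autocorrelation f : ℝ → ℂ) (rotFst θ (intVec n)) *
        𝓕⁻ (g : ℝ → ℂ) (rotSnd θ (intVec n)) := by
    have h := (summable_norm_fourier_mul_rot hA hAs (integrable_fourier_autocorrelation f)
      (𝓕 g).hasDecay θ).of_norm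
    rw [← (Equiv.neg _).summable_iff] at h
    convert! h using 2 with n
    simp [intVec_neg, rotFst_neg, rotSnd_neg, Real.fourierInv_eq_fourier_neg,
      SchwartzMap.fourier_coe]
  refine ((isAtomic_latticeMeasure θ g.hasDecay).smul (conj lam)).hasIntegral hcont.measurable ?_
  rw [← ((isAtomic_latticeMeasure θ g.hasDecay).hasSum (autocorrelation f)).tsum_eq]
  simpa only [hinv, fourierInv_eigenfunction hg hlam] using
    hasSum_fourierInv_mul_rot hA g.continuous (.of_hasCompactSupport hA hAs) g.hasDecay θ hsum

end Eigenfunction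

/-! ### Nonvanishing for irrational slope. -/

section Irrational

variable {θ : ℝ}

lemma rotFst_intVec_injective (hθ : Irrational (Real.tan θ)) :
    Function.Injective fun n : Fin 2 → ℤ => rotFst θ (intVec n) := by
  intro m n h
  -- If the cosine vanished, `tan θ` would be 0 by the convention for division by zero, hence
  -- rational.
  have hcos : Real.cos θ ≠ 0 := fun h0 => hθ ⟨0, by simp [Real.tan_eq_sin_div_cos, h0]⟩
  have h' : Real.cos θ * (m 0 - n 0) = Real.sin θ * (m 1 - n 1) := by
    simp only [rotFst, intVec] at h
    linear_combination h
  have h1 : m 1 = n 1 := by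
    by_contra hne
    have hne' : (m 1 - n 1 : ℝ) ≠ 0 := sub_ne_zero.2 (by exact_mod_cast hne)
    refine hθ ⟨(m 0 - n 0 : ℚ) / (m 1 - n 1), ?_⟩
    rw [Real.tan_eq_sin_div_cos]
    push_cast
    rw [div_eq_div_iff hne' hcos]
    linear_combination h'
  have h0 : m 0 = n 0 := by
    rw [h1, sub_self, mul_zero] at h'
    exact_mod_cast sub_eq_zero.1 ((mul_eq_zero.1 h').resolve_left hcos)
  ext i
  fin_cases i
  exacts [h0, h1]

lemma denseRange_rotSnd_intVec (hθ : Irrational (Real.tan θ)) :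
    DenseRange fun n : Fin 2 → ℤ => rotSnd θ (intVec n) := by
  rw [Real.tan_eq_sin_div_cos] at hθ
  refine (dense_addSubgroupClosure_pair_iff.2 hθ).mono fun z hz => ?_
  obtain ⟨a, b, rfl⟩ := AddSubgroup.mem_closure_pair.1 hz
  exact ⟨![a, b], by simp [rotSnd, intVec, mul_comm]⟩

/-- Density puts a second coordinate in the open set where `ψ ≠ 0`; injectivity of the first
coordinate makes the atom there consist of this single weight, so nothing can cancel it. -/
lemma latticeMeasure_ne_zero (hθ : Irrational (Real.tan θ)) {ψ : ℝ → ℂ} (hψ : HasDecay ψ)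
    (hc : Continuous ψ) (h0 : ψ ≠ 0) : latticeMeasure θ hψ ≠ 0 := by
  intro hz
  obtain ⟨x, hx⟩ := Function.ne_iff.1 h0
  obtain ⟨n, hn⟩ := (denseRange_rotSnd_intVec hθ).exists_mem_open
    (isOpen_compl_singleton.preimage hc : IsOpen (ψ ⁻¹' {0}ᶜ)) ⟨x, hx⟩
  apply hn
  have h := (isAtomic_latticeMeasure θ hψ).atomWeight_eq_zero hz (rotFst θ (intVec n))
  rw [atomWeight, tsum_eq_single ⟨n, rfl⟩] at h
  · exact h
  · rintro ⟨m, hm⟩ hne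
    have hmn : rotFst θ (intVec m) = rotFst θ (intVec n) := hm
    exact absurd (Subtype.ext (rotFst_intVec_injective hθ hmn)) hne

end Irrational

theorem theorem5p1 (θ : ℝ) (g : 𝓢(ℝ, ℂ)) (hg : g ≠ 0) (lam : ℂ) (hlam : 𝓕 g = lam • g) :
    ∃ ω : RadonMeasure,
      -- `ω(φ) = ∑_{z ∈ Γ_θ} (φ ⊗ g)(z)`, absolutely convergent, for `φ` in `C_c(ℝ)` ...
      (∀ φ : C_c(ℝ, ℂ),
        HasSum (fun z : rotatedLattice θ => φ (z.1 0) * g (z.1 1)) (ω.1 φ)) ∧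
      -- ... and also for Schwartz functions `φ`
      (∃ T : 𝓢'(ℝ, ℂ), ω.IsRepresentedBy T ∧ ∀ φ : 𝓢(ℝ, ℂ),
        HasSum (fun z : rotatedLattice θ => φ (z.1 0) * g (z.1 1)) (T φ)) ∧
      ω.TranslationBounded ∧
      ω.HasFourierTransform (conj lam • ω) ∧
      ω.HasStrictFourierTransform (conj lam • ω) ∧
      (ω ≠ 0 → ω.IsStrictEigenmeasure (conj lam)) ∧
      (Irrational (Real.tan θ) → ω.IsStrictEigenmeasure (conj lam)) := by
  have hft := hasFourierTransform_latticeMeasure θ hg hlam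
  have hst := hasStrictFourierTransform_latticeMeasure θ hg hlam
  refine ⟨latticeMeasure θ g.hasDecay, fun φ => ?_, ⟨latticeDistribution θ g.hasDecay,
    isRepresentedBy_latticeDistribution θ _, fun φ => ?_⟩,
    translationBounded_latticeMeasure θ _, hft, hst, fun h => ⟨⟨h, hft⟩, hst⟩,
    fun hθ => ⟨⟨latticeMeasure_ne_zero hθ _ g.continuous ?_, hft⟩, hst⟩⟩
  · exact (hasSum_rotatedLattice_iff θ).2 ((isAtomic_latticeMeasure θ g.hasDecay).hasSum φ)
  · exact (hasSum_rotatedLattice_iff θ).2 (hasSum_latticeDistribution θ g.hasDecay φ)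
  · exact fun h => hg (DFunLike.coe_injective h)
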